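/- Let $\mathcal H$ be a complex Hilbert space (inner product linear in the second argument). For a unitary operator $K$ on $\mathcal H$ and an operator $T$ in $\mathcal H$, let $K^*TK$ be the operator with its natural domain $\mathcal D(K^*TK)=\{f\in\mathcal H : Kf\in\mathcal D(T)\}$; a densely defined closable operator $T$ is called $K$-invariant if $K^*TK=T$, including equality of domains. Let $S$ be a densely defined, closed, symmetric operator in $\mathcal H$ that is strictly positive, i.e. $\langle f,Sf\rangle\ge\varepsilon\|f\|^2$ for all $f\in\mathcal D(S)$ and some $\varepsilon>0$. Let $S_F$ be its Friedrichs extension, i.e. the restriction of $S^*$ to those $f\in\mathcal D(S^*)$ for which there are $f_n\in\mathcal D(S)$ with $f_n\to f$ and $\langle f_n-f_m,S(f_n-f_m)\rangle\to0$ as $n,m\to\infty$. Let $B$ be a linear operator with $\overline{\mathcal D(B)}\subseteq\ker(S^*)$ that is a nonnegative self-adjoint operator or a maximally dissipative operator in the Hilbert space $\overline{\mathcal D(B)}$. Here a densely defined operator $A$ is called dissipative if $\operatorname{Im}\langle f,Af\rangle\ge0$ for all $f\in\mathcal D(A)$, and maximally dissipative if moreover it has no nontrivial dissipative extension. Let $S_B$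 be the restriction of $S^*$ to $$\mathcal D(S_B)=\mathcal D(S)\,\dot+\,\{S_F^{-1}Bf+f : f\in\mathcal D(B)\}\,\dot+\,\{S_F^{-1}\eta : \eta\in\mathcal D(B)^\perp\cap\ker(S^*)\}.$$ Let $K$ be a unitary operator on $\mathcal H$ such that $S$ is $K$-invariant. Then $S_B$ is $K$-invariant if and only if $\mathcal D(B)=\mathcal D(K^*BK)$ and $K^*BK=B$. -/

import Mathlib

open Filter Topology

namespace UnboundedOp

noncomputable section

variable {E : Type*} [NormedAddCommGroup E] [InnerProductSpace ℂ E]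

/-- The kernel of a partially defined operator, as a subspace of the whole space. -/
def ker (T : E →ₗ.[ℂ] E) : Submodule ℂ E :=
  (LinearMap.ker T.toFun).map T.domain.subtype

/-- `T` is densely defined and symmetric: `⟪T f, g⟫ = ⟪f, T g⟫` for `f, g` in the domain. -/
structure IsSymmetric (T : E →ₗ.[ℂ] E) : Prop where
  dense : Dense (T.domain : Set E)
  symm : T.IsFormalAdjoint T

/-- `T` is a nonnegative symmetric operator. -/
structure IsNonnegSymmetric (T : E →ₗ.[ℂ] E) : Prop extends IsSymmetric T where
  nonneg : ∀ f : T.domain, 0 ≤ (inner ℂ (f : E) (T f)).re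

/-- `T` is a strictly positive symmetric operator: `⟪f, T f⟫ ≥ ε ‖f‖²` for some `ε > 0`.
(The inner product is real because `T` is symmetric.) -/
structure IsStrictlyPositive (T : E →ₗ.[ℂ] E) : Prop extends IsSymmetric T where
  pos : ∃ ε : ℝ, 0 < ε ∧ ∀ f : T.domain, ε * ‖(f : E)‖ ^ 2 ≤ (inner ℂ (f : E) (T f)).re

theorem IsStrictlyPositive.isNonnegSymmetric {T : E →ₗ.[ℂ] E} (hT : IsStrictlyPositive T) :
    IsNonnegSymmetric T where
  toIsSymmetric := hT.toIsSymmetric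
  nonneg f := by
    obtain ⟨ε, hε, h⟩ := hT.pos
    exact le_trans (by positivity) (h f)

/-- `T` is dissipative: densely defined, with `Im ⟪f, T f⟫ ≥ 0` for all `f` in the domain. -/
structure IsDissipative (T : E →ₗ.[ℂ] E) : Prop where
  dense : Dense (T.domain : Set E)
  im_nonneg : ∀ f : T.domain, 0 ≤ (inner ℂ (f : E) (T f)).im

/-- `T` is dissipative and has no nontrivial dissipative extension. -/
structure IsMaximallyDissipative (T : E →ₗ.[ℂ] E) : Prop extends IsDissipative T where
  maximal : ∀ T' : E →ₗ.[ℂ] E, IsDissipative T' → T ≤ T' → T' = T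

/-- `T` is self-adjoint (in particular densely defined) and nonnegative. -/
structure IsNonnegSelfAdjoint [CompleteSpace E] (T : E →ₗ.[ℂ] E) : Prop where
  selfAdjoint : IsSelfAdjoint T
  nonneg : ∀ f : T.domain, 0 ≤ (inner ℂ (f : E) (T f)).re

/-- An operator `B` whose values lie in the closure of its domain, regarded as a (densely defined)
operator in the Hilbert space `closure (D(B))`. -/
def inClosure (B : E →ₗ.[ℂ] E) (hB : ∀ f : B.domain, B f ∈ B.domain.topologicalClosure) :
    B.domain.topologicalClosure →ₗ.[ℂ] B.domain.topologicalClosure where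
  domain := B.domain.comap B.domain.topologicalClosure.subtype
  toFun :=
    { toFun := fun f => ⟨B ⟨f.1.1, f.2⟩, hB _⟩
      map_add' := fun f g => Subtype.ext (B.map_add ⟨f.1.1, f.2⟩ ⟨g.1.1, g.2⟩)
      map_smul' := fun c f => Subtype.ext (B.map_smul c ⟨f.1.1, f.2⟩) }

variable [CompleteSpace E]

/-- The operator `K* T K` on its natural domain `{f | K f ∈ D(T)}`. -/
def conj (K : E →L[ℂ] E) (T : E →ₗ.[ℂ] E) : E →ₗ.[ℂ] E where
  domain := T.domain.comap (K : E →ₗ[ℂ] E)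
  toFun :=
    { toFun := fun f => ContinuousLinearMap.adjoint K (T ⟨K f, f.2⟩)
      map_add' := fun f g => by
        rw [← map_add, ← T.map_add]
        congr 2
        exact Subtype.ext (map_add K f.1 g.1)
      map_smul' := fun c f => by
        rw [RingHom.id_apply, ← map_smul, ← T.map_smul]
        congr 2
        exact Subtype.ext (map_smul K c f.1) }

/-- `T` is `K`-invariant: `K` is bounded and boundedly invertible, `T` is densely defined and
closable, and `K* T K = T` (equality of operators, including equality of domains). -/
structure IsInvariant (K : E →L[ℂ] E) (T : E →ₗ.[ℂ] E) : Prop where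
  invertible : IsUnit K
  dense : Dense (T.domain : Set E)
  closable : T.IsClosable
  conj_eq : conj K T = T

/-- The domain of the Friedrichs extension of a nonnegative symmetric operator `S`: all
`f ∈ D(S*)` that are limits of a sequence `uₙ ∈ D(S)` with `⟪uₙ - uₘ, S (uₙ - uₘ)⟫ → 0`
as `n, m → ∞`. -/
def friedrichsDomain (S : E →ₗ.[ℂ] E) (hS : IsNonnegSymmetric S) : Submodule ℂ E where
  carrier := {f | f ∈ S.adjoint.domain ∧ ∃ u : ℕ → S.domain,
    Tendsto (fun n => (u n : E)) atTop (𝓝 f) ∧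
    Tendsto (fun p : ℕ × ℕ => inner ℂ ((u p.1 - u p.2 : S.domain) : E) (S (u p.1 - u p.2)))
      atTop (𝓝 0)}
  zero_mem' := ⟨zero_mem _, fun _ => 0, by simp, by simp⟩
  add_mem' := by
    rintro f g ⟨hf, u, hu, hu'⟩ ⟨hg, v, hv, hv'⟩
    refine ⟨add_mem hf hg, fun n => u n + v n, by simpa using hu.add hv, ?_⟩
    have him : ∀ x : S.domain, (inner ℂ (x : E) (S x)).im = 0 := fun x => by
      have h := hS.symm x x
      rw [← inner_conj_symm] at h
      exact Complex.conj_eq_iff_im.mp h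
    have key : ∀ x y : S.domain, ‖inner ℂ ((x + y : S.domain) : E) (S (x + y))‖ ≤
        2 * ‖inner ℂ (x : E) (S x)‖ + 2 * ‖inner ℂ (y : E) (S y)‖ := fun x y => by
      have hn : ∀ z : S.domain, ‖inner ℂ (z : E) (S z)‖ = (inner ℂ (z : E) (S z)).re := fun z => by
        rw [← Complex.abs_re_eq_norm.mpr (him z), abs_of_nonneg (hS.nonneg z)]
      have hp : inner ℂ ((x + y : S.domain) : E) (S (x + y)) +
          inner ℂ ((x - y : S.domain) : E) (S (x - y)) =
          2 * inner ℂ (x : E) (S x) + 2 * inner ℂ (y : E) (S y) := by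
        simp only [S.map_add, S.map_sub, Submodule.coe_add, Submodule.coe_sub, inner_add_left,
          inner_add_right, inner_sub_left, inner_sub_right]
        ring
      have hr := congrArg Complex.re hp
      simp only [Complex.add_re, Complex.mul_re, Complex.re_ofNat, Complex.im_ofNat, zero_mul,
        sub_zero] at hr
      rw [hn, hn, hn]
      linarith [hS.nonneg (x - y)]
    have h0 := ((hu'.norm.const_mul 2).add (hv'.norm.const_mul 2))
    simp only [norm_zero, mul_zero, add_zero] at h0
    refine squeeze_zero_norm (fun p => ?_) h0
    rw [add_sub_add_comm]
    exact key _ _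
  smul_mem' := by
    rintro c f ⟨hf, u, hu, hu'⟩
    refine ⟨Submodule.smul_mem _ c hf, fun n => c • u n, by simpa using hu.const_smul c, ?_⟩
    have h := (hu'.const_mul (c * (starRingEnd ℂ) c))
    rw [mul_zero] at h
    refine h.congr fun p => ?_
    rw [← smul_sub, S.map_smul, Submodule.coe_smul, inner_smul_left, inner_smul_right]
    ring

/-- The Friedrichs extension `S_F`: the restriction of `S*` to `friedrichsDomain`. -/
def friedrichs (S : E →ₗ.[ℂ] E) (hS : IsNonnegSymmetric S) : E →ₗ.[ℂ] E :=
  S.adjoint.domRestrict (friedrichsDomain S hS)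

/-- The subspace `{S_F⁻¹ B f + f | f ∈ D(B)}`; here `g = S_F⁻¹ B f` is written as
`(B f, g) ∈ graph (S_F⁻¹)`. -/
def graphPart (S : E →ₗ.[ℂ] E) (hS : IsNonnegSymmetric S) (B : E →ₗ.[ℂ] E) : Submodule ℂ E where
  carrier := {x | ∃ (f : B.domain) (g : E),
    (B f, g) ∈ (friedrichs S hS).inverse.graph ∧ x = g + f}
  zero_mem' := ⟨0, 0, by rw [B.map_zero]; exact zero_mem _, by simp⟩
  add_mem' := by
    rintro x y ⟨f, g, hg, rfl⟩ ⟨f', g', hg', rfl⟩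
    refine ⟨f + f', g + g', ?_, by rw [Submodule.coe_add]; abel⟩
    rw [B.map_add]
    exact add_mem hg hg'
  smul_mem' := by
    rintro c x ⟨f, g, hg, rfl⟩
    refine ⟨c • f, c • g, ?_, by rw [Submodule.coe_smul, smul_add]⟩
    rw [B.map_smul]
    exact Submodule.smul_mem _ c hg

/-- The subspace `{S_F⁻¹ η | η ∈ D(B)ᗮ ∩ ker S*}`. -/
def orthogonalPart (S : E →ₗ.[ℂ] E) (hS : IsNonnegSymmetric S) (B : E →ₗ.[ℂ] E) :
    Submodule ℂ E where
  carrier := {x | ∃ η ∈ B.domainᗮ ⊓ ker S.adjoint, (η, x) ∈ (friedrichs S hS).inverse.graph}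
  zero_mem' := ⟨0, zero_mem _, zero_mem _⟩
  add_mem' := by
    rintro x y ⟨η, hη, hx⟩ ⟨η', hη', hy⟩
    exact ⟨η + η', add_mem hη hη', add_mem hx hy⟩
  smul_mem' := by
    rintro c x ⟨η, hη, hx⟩
    exact ⟨c • η, Submodule.smul_mem _ c hη, Submodule.smul_mem _ c hx⟩

/-- The extension `S_B` of `S` with auxiliary operator `B`: the restriction of `S*` to
`D(S) ∔ {S_F⁻¹ B f + f | f ∈ D(B)} ∔ {S_F⁻¹ η | η ∈ D(B)ᗮ ∩ ker S*}`. -/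
def extension (S : E →ₗ.[ℂ] E) (hS : IsNonnegSymmetric S) (B : E →ₗ.[ℂ] E) : E →ₗ.[ℂ] E :=
  S.adjoint.domRestrict (S.domain ⊔ graphPart S hS B ⊔ orthogonalPart S hS B)

/-- `B` is an admissible auxiliary operator for `S`: `closure (D(B)) ⊆ ker S*`, and `B` is a
nonnegative self-adjoint or a maximally dissipative operator in the Hilbert space
`closure (D(B))`. -/
structure IsAuxiliary (S B : E →ₗ.[ℂ] E) : Prop where
  le_ker : B.domain.topologicalClosure ≤ ker S.adjoint
  maps : ∀ f : B.domain, B f ∈ B.domain.topologicalClosure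
  nonnegSelfAdjoint_or_maximallyDissipative :
    IsNonnegSelfAdjoint (inClosure B maps) ∨ IsMaximallyDissipative (inClosure B maps)

end

end UnboundedOp

/-!
The energy form `⟪f, S g⟫` makes `D(S)` a pre-Hilbert space embedded continuously in the ambient
space. Riesz representation in its completion shows that `S_F` is onto, and an energy-Cauchy
sequence with limit in `ker S*` is weakly null, hence null, so `S_F` is injective. Consequently
every element of `D(S_B)` is a sum `g + f` with `g ∈ D(S_F)`, `f ∈ D(B)` and
`S_F g - B f ∈ ran S + (D(B)ᗮ ∩ ker S*) ⊆ D(B)ᗮ`; the sum is direct because `D(S_F)` meets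
`ker S*` trivially, and `S_B (g + f) = S_F g`.

A unitary `K` commuting with `S` commutes with `S*` and `S_F` as well. If it also commutes with `B`,
it preserves this description of `S_B`. Conversely, let `K` commute with `S_B` and let `f ∈ D(B)`.
Applying `K` to `S_F⁻¹ B f + f` gives `K f ∈ D(B)` and `K B f - B K f ∈ D(B)ᗮ`. The latter vector
also lies in the closure of `D(B)`, which contains the range of `B` and is preserved by `K`, so it
vanishes.
-/

namespace UnboundedOp

section Graph

variable {R E F : Type*} [Ring R] [AddCommGroup E] [Module R E] [AddCommGroup F] [Module R F]

theorem mem_graph_domRestrict {T : E →ₗ.[R] F} {V : Submodule R E} {x : E} {y : F} :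
    (x, y) ∈ (T.domRestrict V).graph ↔ x ∈ V ∧ (x, y) ∈ T.graph := by
  simp only [LinearPMap.mem_graph_iff]
  constructor
  · rintro ⟨⟨z, hz⟩, rfl, h⟩
    exact ⟨hz.1, ⟨z, hz.2⟩, rfl, h⟩
  · rintro ⟨hx, ⟨z, hz⟩, rfl, h⟩
    exact ⟨⟨z, hx, hz⟩, rfl, h⟩

theorem mem_graph_inverse_iff {T : E →ₗ.[R] F} (hT : LinearMap.ker T.toFun = ⊥) {x : E} {y : F} :
    (y, x) ∈ T.inverse.graph ↔ (x, y) ∈ T.graph := by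
  rw [LinearPMap.inverse_graph hT]
  simp [-LinearPMap.mem_graph_iff]

end Graph

section AdjointGraph

variable {𝕜 E F : Type*} [RCLike 𝕜] [NormedAddCommGroup E] [InnerProductSpace 𝕜 E]
  [CompleteSpace E] [NormedAddCommGroup F] [InnerProductSpace 𝕜 F]

theorem mem_graph_adjoint_iff {T : E →ₗ.[𝕜] F} (hT : Dense (T.domain : Set E)) {x : F} {y : E} :
    (x, y) ∈ T.adjoint.graph ↔ ∀ v : T.domain, inner 𝕜 x (T v) = inner 𝕜 y (v : E) := by
  rw [LinearPMap.mem_graph_iff]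
  constructor
  · rintro ⟨z, rfl, rfl⟩ v
    exact (LinearPMap.adjoint_isFormalAdjoint hT z v).symm
  · intro h
    have hx : x ∈ T.adjoint.domain :=
      LinearPMap.mem_adjoint_domain_of_exists x ⟨y, fun v => (h v).symm⟩
    exact ⟨⟨x, hx⟩, rfl, LinearPMap.adjoint_apply_eq hT _ fun v => (h v).symm⟩

end AdjointGraph

section Cauchy

variable {𝕜 F : Type*} [RCLike 𝕜] [SeminormedAddCommGroup F] [InnerProductSpace 𝕜 F]

open UniformSpace

theorem exists_cauchySeq_tendsto_inner (φ : F →L[𝕜] 𝕜) :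
    ∃ u : ℕ → F, CauchySeq u ∧ ∀ v, Tendsto (fun n => inner 𝕜 (u n) v) atTop (𝓝 (φ v)) := by
  let Φ : Completion F →L[𝕜] 𝕜 := φ.extend (Completion.toComplL : F →L[𝕜] Completion F)
  have hΦ (v : F) : Φ v = φ v :=
    φ.extend_eq Completion.denseRange_coe (Completion.isUniformInducing_coe F) v
  set w := (InnerProductSpace.toDual 𝕜 (Completion F)).symm Φ
  obtain ⟨z, hz, hzw⟩ := mem_closure_iff_seq_limit.1 (Completion.denseRange_coe w)
  choose u hu using hz
  obtain rfl : (fun n => (u n : Completion F)) = z := funext hu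
  have hu : CauchySeq u := (Completion.isUniformInducing_coe F).cauchy_map_iff.1 hzw.cauchySeq
  refine ⟨u, hu, fun v => ?_⟩
  have hlim := hzw.inner (𝕜 := 𝕜) (tendsto_const_nhds (x := (v : Completion F)))
  rw [InnerProductSpace.toDual_symm_apply, hΦ] at hlim
  simpa only [Completion.inner_coe] using hlim

theorem tendsto_zero_of_cauchySeq_of_tendsto_inner_zero {u : ℕ → F} (hu : CauchySeq u)
    (h : ∀ v, Tendsto (fun n => inner 𝕜 (u n) v) atTop (𝓝 0)) : Tendsto u atTop (𝓝 0) := by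
  obtain ⟨w, hw⟩ := cauchySeq_tendsto_of_complete
    ((Completion.uniformContinuous_coe F).comp_cauchySeq hu)
  have hperp (v : F) : inner 𝕜 w (v : Completion F) = 0 := by
    refine tendsto_nhds_unique (hw.inner tendsto_const_nhds) ?_
    simpa only [Function.comp_apply, Completion.inner_coe] using h v
  have hw0 : w = 0 := Completion.denseRange_coe.eq_zero_of_inner_left 𝕜 hperp
  rw [tendsto_zero_iff_norm_tendsto_zero]
  simpa only [Function.comp_apply, Completion.norm_coe, hw0, norm_zero] using hw.norm

end Cauchy

variable {E : Type*} [NormedAddCommGroup E] [InnerProductSpace ℂ E]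

theorem mem_ker_iff {T : E →ₗ.[ℂ] E} {x : E} : x ∈ ker T ↔ (x, 0) ∈ T.graph := by
  simp only [ker, Submodule.mem_map, LinearMap.mem_ker, LinearPMap.mem_graph_iff]
  exact ⟨fun ⟨y, hy, h⟩ => ⟨y, h, hy⟩, fun ⟨y, h, hy⟩ => ⟨y, hy, h⟩⟩

section Intertwines

/-- `K T ⊆ T K`: the bounded operator `K` maps the graph of `T` into itself. -/
def Intertwines (K : E →L[ℂ] E) (T : E →ₗ.[ℂ] E) : Prop :=
  ∀ ⦃x y : E⦄, (x, y) ∈ T.graph → (K x, K y) ∈ T.graph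

variable {K : E →L[ℂ] E} {T : E →ₗ.[ℂ] E}

namespace Intertwines

theorem mem_domain (h : Intertwines K T) {x : E} (hx : x ∈ T.domain) : K x ∈ T.domain :=
  LinearPMap.mem_domain_of_mem_graph (h (T.mem_graph ⟨x, hx⟩))

theorem apply (h : Intertwines K T) (x : T.domain) :
    T ⟨K x, h.mem_domain x.2⟩ = K (T x) :=
  T.mem_graph_snd_inj (T.mem_graph ⟨K x, h.mem_domain x.2⟩) (h (T.mem_graph x)) rfl

theorem mem_ker (h : Intertwines K T) {x : E} (hx : x ∈ ker T) : K x ∈ ker T := by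
  rw [mem_ker_iff] at hx ⊢
  simpa only [map_zero] using h hx

end Intertwines

end Intertwines

section EnergySpace

variable {S : E →ₗ.[ℂ] E}

/-- The domain of a nonnegative symmetric operator `S` with the energy form `⟪f, S g⟫` as
(semidefinite) inner product. It is a type synonym of `S.domain`, which keeps this topology apart
from the one induced by the ambient space. -/
def EnergySpace (_hS : IsNonnegSymmetric S) : Type _ := S.domain

namespace EnergySpace

variable (hS : IsNonnegSymmetric S)

instance : AddCommGroup (EnergySpace hS) := inferInstanceAs (AddCommGroup S.domain)

instance : Module ℂ (EnergySpace hS) := inferInstanceAs (Module ℂ S.domain)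

/-- The identity map from the energy space of `S` to the domain of `S`. -/
def toDomain : EnergySpace hS ≃ₗ[ℂ] S.domain := LinearEquiv.refl ℂ S.domain

/-- The energy form `⟪f, S g⟫` on the domain of `S`. -/
@[reducible]
noncomputable def core : PreInnerProductSpace.Core ℂ (EnergySpace hS) where
  inner f g := inner ℂ (toDomain hS f : E) (S (toDomain hS g))
  conj_inner_symm f g := by rw [inner_conj_symm]; exact hS.symm _ _
  re_inner_nonneg f := hS.nonneg _
  add_left f g h := by rw [map_add, Submodule.coe_add, inner_add_left]
  smul_left f g c := by rw [map_smul, Submodule.coe_smul, inner_smul_left]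

noncomputable instance : SeminormedAddCommGroup (EnergySpace hS) :=
  @InnerProductSpace.Core.toSeminormedAddCommGroup ℂ _ _ _ _ (core hS)

noncomputable instance : InnerProductSpace ℂ (EnergySpace hS) := InnerProductSpace.ofCore (core hS)

theorem inner_def (f g : EnergySpace hS) :
    inner ℂ f g = inner ℂ (toDomain hS f : E) (S (toDomain hS g)) :=
  rfl

theorem cauchySeq_iff_tendsto_energy {u : ℕ → S.domain} :
    CauchySeq (fun n => (toDomain hS).symm (u n)) ↔
      Tendsto (fun p : ℕ × ℕ => inner ℂ ((u p.1 - u p.2 : S.domain) : E) (S (u p.1 - u p.2)))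
        atTop (𝓝 0) := by
  have henergy (f : S.domain) :
      ‖(inner ℂ (f : E) (S f) : ℂ)‖ = ‖(toDomain hS).symm f‖ ^ 2 := by
    have h := inner_self_eq_norm_sq_to_K (𝕜 := ℂ) ((toDomain hS).symm f)
    rw [inner_def, LinearEquiv.apply_symm_apply] at h
    rw [h, norm_pow, RCLike.norm_ofReal, abs_norm]
  rw [cauchySeq_iff_tendsto_dist_atTop_0, tendsto_zero_iff_norm_tendsto_zero (E := ℂ)]
  simp only [henergy, dist_eq_norm, ← map_sub]
  refine ⟨fun h => by simpa using h.pow 2, fun h => ?_⟩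
  simpa [Real.sqrt_sq] using h.sqrt

end EnergySpace

variable (hS : IsStrictlyPositive S)

/-- The embedding of the energy space of a strictly positive operator into the ambient space. -/
noncomputable def energyEmbedding : EnergySpace hS.isNonnegSymmetric →L[ℂ] E :=
  (S.domain.subtype ∘ₗ (EnergySpace.toDomain _).toLinearMap).mkContinuousOfExistsBound <| by
    obtain ⟨ε, hε, hpos⟩ := hS.pos
    refine ⟨(√ε)⁻¹, fun f => ?_⟩
    have hle : ε * ‖(EnergySpace.toDomain _ f : E)‖ ^ 2 ≤ ‖f‖ ^ 2 :=
      (hpos _).trans_eq (norm_sq_eq_re_inner (𝕜 := ℂ) f).symm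
    rw [inv_mul_eq_div, le_div_iff₀' (Real.sqrt_pos.2 hε)]
    refine le_of_sq_le_sq ?_ (norm_nonneg f)
    rwa [mul_pow, Real.sq_sqrt hε.le]

end EnergySpace

variable [CompleteSpace E]

section Friedrichs

variable {S : E →ₗ.[ℂ] E}

theorem IsSymmetric.mem_graph_adjoint (hS : IsSymmetric S) (v : S.domain) :
    ((v : E), S v) ∈ S.adjoint.graph :=
  (mem_graph_adjoint_iff hS.dense).2 fun w => (hS.symm v w).symm

theorem mem_graph_friedrichs (hS : IsNonnegSymmetric S) {x y : E} :
    (x, y) ∈ (friedrichs S hS).graph ↔ x ∈ friedrichsDomain S hS ∧ (x, y) ∈ S.adjoint.graph :=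
  mem_graph_domRestrict

theorem IsNonnegSymmetric.mem_graph_friedrichs_of_domain (hS : IsNonnegSymmetric S)
    (v : S.domain) : ((v : E), S v) ∈ (friedrichs S hS).graph :=
  (mem_graph_friedrichs hS).2
    ⟨⟨LinearPMap.mem_domain_of_mem_graph (hS.mem_graph_adjoint v), fun _ => v,
      tendsto_const_nhds, by simp⟩, hS.mem_graph_adjoint v⟩

namespace IsStrictlyPositive

variable (hS : IsStrictlyPositive S)
include hS

theorem disjoint_friedrichsDomain_ker_adjoint :
    Disjoint (friedrichsDomain S hS.isNonnegSymmetric) (ker S.adjoint) := by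
  rw [Submodule.disjoint_def]
  rintro x ⟨-, u, hu, hcauchy⟩ hker
  rw [← EnergySpace.cauchySeq_iff_tendsto_energy hS.isNonnegSymmetric] at hcauchy
  rw [mem_ker_iff, mem_graph_adjoint_iff hS.dense] at hker
  have hweak (v : EnergySpace hS.isNonnegSymmetric) :
      Tendsto (fun n => inner ℂ ((EnergySpace.toDomain _).symm (u n)) v) atTop (𝓝 0) := by
    have h := hu.inner (𝕜 := ℂ) (tendsto_const_nhds (x := S (EnergySpace.toDomain _ v)))
    rwa [hker, inner_zero_left] at h
  have henergy := tendsto_zero_of_cauchySeq_of_tendsto_inner_zero hcauchy hweak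
  have hzero := ((energyEmbedding hS).continuous.tendsto 0).comp henergy
  rw [map_zero] at hzero
  exact tendsto_nhds_unique hu hzero

theorem ker_friedrichs :
    LinearMap.ker (friedrichs S hS.isNonnegSymmetric).toFun = ⊥ := by
  rw [LinearMap.ker_eq_bot']
  intro x hx
  have hgraph := (friedrichs S hS.isNonnegSymmetric).mem_graph x
  rw [show friedrichs S hS.isNonnegSymmetric x = 0 from hx, mem_graph_friedrichs,
    ← mem_ker_iff] at hgraph
  exact Subtype.ext
    (Submodule.disjoint_def.1 hS.disjoint_friedrichsDomain_ker_adjoint _ hgraph.1 hgraph.2)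

theorem eq_of_mem_graph_friedrichs {x x' y : E}
    (hx : (x, y) ∈ (friedrichs S hS.isNonnegSymmetric).graph)
    (hx' : (x', y) ∈ (friedrichs S hS.isNonnegSymmetric).graph) : x = x' := by
  rw [← mem_graph_inverse_iff hS.ker_friedrichs] at hx hx'
  exact LinearPMap.mem_graph_snd_inj _ hx hx' rfl

theorem exists_mem_graph_friedrichs (y : E) :
    ∃ x, (x, y) ∈ (friedrichs S hS.isNonnegSymmetric).graph := by
  obtain ⟨u, hcauchy, hweak⟩ :=
    exists_cauchySeq_tendsto_inner ((innerSL ℂ y).comp (energyEmbedding hS))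
  obtain ⟨x, hx⟩ := cauchySeq_tendsto_of_complete
    ((energyEmbedding hS).uniformContinuous.comp_cauchySeq hcauchy)
  have hgraph : (x, y) ∈ S.adjoint.graph := (mem_graph_adjoint_iff hS.dense).2 fun v =>
    tendsto_nhds_unique (hx.inner tendsto_const_nhds)
      (hweak ((EnergySpace.toDomain _).symm v))
  exact ⟨x, (mem_graph_friedrichs _).2
    ⟨⟨LinearPMap.mem_domain_of_mem_graph hgraph, fun n => EnergySpace.toDomain _ (u n), hx,
      (EnergySpace.cauchySeq_iff_tendsto_energy _).1 hcauchy⟩, hgraph⟩⟩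

end IsStrictlyPositive

end Friedrichs

section StarCommutes

/-- Both `K` and its adjoint intertwine `T`. For unitary `K` this is the invariance
`K* T K = T`. -/
structure StarCommutes (K : E →L[ℂ] E) (T : E →ₗ.[ℂ] E) : Prop where
  intertwines : Intertwines K T
  star_intertwines : Intertwines (star K) T

variable {K : E →L[ℂ] E} {T : E →ₗ.[ℂ] E}

namespace Intertwines

theorem mem_orthogonal_domain (h : Intertwines (star K) T) {x : E} (hx : x ∈ T.domainᗮ) :
    K x ∈ T.domainᗮ := by
  rw [Submodule.mem_orthogonal] at hx ⊢
  intro v hv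
  rw [← ContinuousLinearMap.adjoint_inner_left]
  exact hx _ (h.mem_domain hv)

theorem adjoint (hT : Dense (T.domain : Set E)) (h : Intertwines (star K) T) :
    Intertwines K T.adjoint := by
  intro x y hxy
  rw [mem_graph_adjoint_iff hT] at hxy ⊢
  intro v
  calc inner ℂ (K x) (T v) = inner ℂ x (star K (T v)) :=
        (ContinuousLinearMap.adjoint_inner_right K _ _).symm
    _ = inner ℂ x (T ⟨star K v, h.mem_domain v.2⟩) := by rw [h.apply]
    _ = inner ℂ y (star K (v : E)) := hxy _
    _ = inner ℂ (K y) (v : E) := ContinuousLinearMap.adjoint_inner_right K _ _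

end Intertwines

theorem StarCommutes.star (h : StarCommutes K T) : StarCommutes (star K) T :=
  ⟨h.star_intertwines, by simpa only [star_star] using h.intertwines⟩

theorem mem_graph_conj_iff (hK : K ∈ unitary (E →L[ℂ] E)) {x y : E} :
    (x, y) ∈ (conj K T).graph ↔ (K x, K y) ∈ T.graph := by
  simp only [LinearPMap.mem_graph_iff]
  constructor
  · rintro ⟨⟨z, hz⟩, rfl, rfl⟩
    exact ⟨⟨K z, hz⟩, rfl,
      (DFunLike.congr_fun (Unitary.mul_star_self_of_mem hK) (T ⟨K z, hz⟩)).symm⟩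
  · rintro ⟨⟨z, hz⟩, rfl, h⟩
    refine ⟨⟨x, hz⟩, rfl, ?_⟩
    change star K (T ⟨K x, hz⟩) = y
    rw [h]
    exact DFunLike.congr_fun (Unitary.star_mul_self_of_mem hK) y

theorem conj_eq_iff_starCommutes (hK : K ∈ unitary (E →L[ℂ] E)) :
    conj K T = T ↔ StarCommutes K T := by
  have hstar (x : E) : star K (K x) = x :=
    DFunLike.congr_fun (Unitary.star_mul_self_of_mem hK) x
  have hstar' (x : E) : K (star K x) = x :=
    DFunLike.congr_fun (Unitary.mul_star_self_of_mem hK) x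
  constructor
  · intro h
    have hgraph (x y : E) : (x, y) ∈ T.graph ↔ (K x, K y) ∈ T.graph := by
      rw [← mem_graph_conj_iff hK, h]
    refine ⟨fun x y => (hgraph x y).1, fun x y hxy => (hgraph _ _).2 ?_⟩
    rwa [hstar', hstar']
  · intro h
    refine LinearPMap.eq_of_eq_graph (Submodule.ext fun ⟨x, y⟩ => ?_)
    rw [mem_graph_conj_iff hK]
    refine ⟨fun hxy => ?_, fun hxy => h.intertwines hxy⟩
    simpa only [hstar] using h.star_intertwines hxy

theorem StarCommutes.intertwines_friedrichs {S : E →ₗ.[ℂ] E} (hK : Isometry K)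
    (hS : IsNonnegSymmetric S) (h : StarCommutes K S) : Intertwines K (friedrichs S hS) := by
  intro x y hxy
  rw [mem_graph_friedrichs] at hxy ⊢
  obtain ⟨⟨hx, u, hu, henergy⟩, hgraph⟩ := hxy
  have hadj : Intertwines K S.adjoint := h.star_intertwines.adjoint hS.dense
  have hinner : ∀ v w : E, inner ℂ (K v) (K w) = inner ℂ v w :=
    K.inner_map_map_iff_adjoint_comp_self.2 (K.isometry_iff_adjoint_comp_self.1 hK)
  refine ⟨⟨hadj.mem_domain hx, fun n => ⟨K (u n), h.intertwines.mem_domain (u n).2⟩,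
    (K.continuous.tendsto x).comp hu, henergy.congr fun p => ?_⟩, hadj hgraph⟩
  simp only [S.map_sub, h.intertwines.apply, Submodule.coe_sub, ← map_sub, hinner]

end StarCommutes

section Extension

variable {K : E →L[ℂ] E} {S B : E →ₗ.[ℂ] E}

/-- The values `S_F g - B f` attained on elements `g + f` of the domain of `S_B`. When `S` is
closed and strictly positive and `D(B) ⊆ ker S*`, this is all of `D(B)ᗮ`, because `ran S` is then
closed with orthogonal complement `ker S*`. -/
noncomputable def residualSpace (S B : E →ₗ.[ℂ] E) : Submodule ℂ E :=
  LinearMap.range S.toFun ⊔ (B.domainᗮ ⊓ ker S.adjoint)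

theorem range_le_orthogonal_ker_adjoint (hS : Dense (S.domain : Set E)) :
    LinearMap.range S.toFun ≤ (ker S.adjoint)ᗮ := by
  rintro _ ⟨v, rfl⟩
  rw [Submodule.mem_orthogonal]
  intro x hx
  have h := (mem_graph_adjoint_iff hS).1 (mem_ker_iff.1 hx) v
  rwa [inner_zero_left] at h

theorem residualSpace_le_orthogonal_domain (hS : Dense (S.domain : Set E))
    (hker : B.domain ≤ ker S.adjoint) : residualSpace S B ≤ B.domainᗮ :=
  sup_le ((range_le_orthogonal_ker_adjoint hS).trans (Submodule.orthogonal_le hker)) inf_le_left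

theorem map_mem_residualSpace (hS : Dense (S.domain : Set E)) (hKS : StarCommutes K S)
    (hKB : Intertwines (star K) B) {y : E} (hy : y ∈ residualSpace S B) :
    K y ∈ residualSpace S B := by
  obtain ⟨_, ⟨v, rfl⟩, η, ⟨hη, hη'⟩, rfl⟩ := Submodule.mem_sup.1 hy
  rw [map_add]
  exact Submodule.add_mem_sup ⟨⟨K v, hKS.intertwines.mem_domain v.2⟩, hKS.intertwines.apply v⟩
    ⟨hKB.mem_orthogonal_domain hη, (hKS.star_intertwines.adjoint hS).mem_ker hη'⟩

theorem IsStrictlyPositive.mem_extensionDomain_iff (hS : IsStrictlyPositive S) {x : E} :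
    x ∈ S.domain ⊔ graphPart S hS.isNonnegSymmetric B ⊔ orthogonalPart S hS.isNonnegSymmetric B ↔
      ∃ g y f b, (g, y) ∈ (friedrichs S hS.isNonnegSymmetric).graph ∧ (f, b) ∈ B.graph ∧
        y - b ∈ residualSpace S B ∧ x = g + f := by
  have hinv {g y : E} : (y, g) ∈ (friedrichs S hS.isNonnegSymmetric).inverse.graph ↔
      (g, y) ∈ (friedrichs S hS.isNonnegSymmetric).graph :=
    mem_graph_inverse_iff hS.ker_friedrichs
  constructor
  · intro hx
    obtain ⟨_, hz, w, ⟨η, hη, hw⟩, rfl⟩ := Submodule.mem_sup.1 hx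
    obtain ⟨s, hs, _, ⟨f, g, hg, rfl⟩, rfl⟩ := Submodule.mem_sup.1 hz
    refine ⟨s + g + w, S ⟨s, hs⟩ + B f + η, f, B f,
      add_mem (add_mem (hS.isNonnegSymmetric.mem_graph_friedrichs_of_domain ⟨s, hs⟩)
        (hinv.1 hg)) (hinv.1 hw), B.mem_graph f, ?_, by abel⟩
    rw [add_right_comm, add_sub_cancel_right]
    exact Submodule.add_mem_sup ⟨⟨s, hs⟩, rfl⟩ hη
  · rintro ⟨g, y, f, b, hg, hf, hres, rfl⟩
    obtain ⟨f, rfl, rfl⟩ := (LinearPMap.mem_graph_iff _).1 hf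
    obtain ⟨_, ⟨s, rfl⟩, η, hη, hsum⟩ := Submodule.mem_sup.1 hres
    obtain ⟨g', hg'⟩ := hS.exists_mem_graph_friedrichs (B f)
    obtain ⟨w, hw⟩ := hS.exists_mem_graph_friedrichs η
    have hsum' : S s + B f + η = y := by
      rw [add_right_comm]
      exact add_eq_of_eq_sub hsum
    have hgraph := add_mem
      (add_mem (hS.isNonnegSymmetric.mem_graph_friedrichs_of_domain s) hg') hw
    obtain rfl : (s : E) + g' + w = g :=
      hS.eq_of_mem_graph_friedrichs (hsum' ▸ hgraph) hg
    rw [show (s : E) + g' + w + f = s + (g' + f) + w by abel]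
    exact Submodule.add_mem_sup (Submodule.add_mem_sup s.2 ⟨f, g', hinv.2 hg', rfl⟩)
      ⟨η, hη, hinv.2 hw⟩

theorem IsStrictlyPositive.mem_graph_extension_iff (hS : IsStrictlyPositive S)
    (hker : B.domain ≤ ker S.adjoint) {x y : E} :
    (x, y) ∈ (extension S hS.isNonnegSymmetric B).graph ↔
      ∃ g f b, (g, y) ∈ (friedrichs S hS.isNonnegSymmetric).graph ∧ (f, b) ∈ B.graph ∧
        y - b ∈ residualSpace S B ∧ x = g + f := by
  have hadj {g y f b : E} (hg : (g, y) ∈ (friedrichs S hS.isNonnegSymmetric).graph)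
      (hf : (f, b) ∈ B.graph) : (g + f, y) ∈ S.adjoint.graph := by
    have hf0 := mem_ker_iff.1 (hker (LinearPMap.mem_domain_of_mem_graph hf))
    simpa only [Prod.mk_add_mk, add_zero] using
      add_mem ((mem_graph_friedrichs _).1 hg).2 hf0
  rw [extension, mem_graph_domRestrict, hS.mem_extensionDomain_iff]
  constructor
  · rintro ⟨⟨g, y', f, b, hg, hf, hres, rfl⟩, hxy⟩
    obtain rfl : y = y' := LinearPMap.mem_graph_snd_inj _ hxy (hadj hg hf) rfl
    exact ⟨g, f, b, hg, hf, hres, rfl⟩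
  · rintro ⟨g, f, b, hg, hf, hres, rfl⟩
    exact ⟨⟨g, y, f, b, hg, hf, hres, rfl⟩, hadj hg hf⟩

theorem StarCommutes.intertwines_extension (hK : Isometry K) (hS : IsStrictlyPositive S)
    (hker : B.domain ≤ ker S.adjoint) (hKS : StarCommutes K S) (hKB : StarCommutes K B) :
    Intertwines K (extension S hS.isNonnegSymmetric B) := by
  intro x y hxy
  rw [hS.mem_graph_extension_iff hker] at hxy ⊢
  obtain ⟨g, f, b, hg, hf, hres, rfl⟩ := hxy
  refine ⟨K g, K f, K b, hKS.intertwines_friedrichs hK _ hg, hKB.intertwines hf, ?_, map_add K g f⟩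
  rw [← map_sub]
  exact map_mem_residualSpace hS.dense hKS hKB.star_intertwines hres

theorem exists_mem_graph_of_intertwines_extension (hK : Isometry K) (hS : IsStrictlyPositive S)
    (hker : B.domain ≤ ker S.adjoint) (hKS : StarCommutes K S)
    (hKSB : Intertwines K (extension S hS.isNonnegSymmetric B)) {f b : E}
    (hf : (f, b) ∈ B.graph) : ∃ b', (K f, b') ∈ B.graph ∧ K b - b' ∈ B.domainᗮ := by
  obtain ⟨g, hg⟩ := hS.exists_mem_graph_friedrichs b
  have hSB : (g + f, b) ∈ (extension S hS.isNonnegSymmetric B).graph :=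
    (hS.mem_graph_extension_iff hker).2 ⟨g, f, b, hg, hf, by simp, rfl⟩
  obtain ⟨g', f', b', hg', hf', hres, hsum⟩ := (hS.mem_graph_extension_iff hker).1 (hKSB hSB)
  obtain rfl : K g = g' :=
    hS.eq_of_mem_graph_friedrichs (hKS.intertwines_friedrichs hK _ hg) hg'
  obtain rfl : K f = f' := by rwa [map_add, add_right_inj] at hsum
  exact ⟨b', hf', residualSpace_le_orthogonal_domain hS.dense hker hres⟩

theorem intertwines_of_intertwines_extension (hK : Isometry K) (hS : IsStrictlyPositive S)
    (hker : B.domain ≤ ker S.adjoint) (hmaps : ∀ f, B f ∈ B.domain.topologicalClosure)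
    (hKS : StarCommutes K S) (hKSB : Intertwines K (extension S hS.isNonnegSymmetric B)) :
    Intertwines K B := by
  have hexists {f b : E} (hf : (f, b) ∈ B.graph) :=
    exists_mem_graph_of_intertwines_extension hK hS hker hKS hKSB hf
  have hclosure {f b : E} (hf : (f, b) ∈ B.graph) : b ∈ B.domain.topologicalClosure := by
    obtain ⟨f, rfl, rfl⟩ := (LinearPMap.mem_graph_iff _).1 hf
    exact hmaps f
  have hdomain : Set.MapsTo K B.domain B.domain := fun v hv => by
    obtain ⟨_, hv', -⟩ := hexists (B.mem_graph ⟨v, hv⟩)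
    exact LinearPMap.mem_domain_of_mem_graph hv'
  intro f b hf
  obtain ⟨b', hf', hperp⟩ := hexists hf
  have hmem : K b - b' ∈ B.domain.topologicalClosure :=
    sub_mem (map_mem_closure K.continuous (hclosure hf) hdomain) (hclosure hf')
  rw [← Submodule.orthogonal_closure] at hperp
  have hzero : K b - b' = 0 :=
    Submodule.disjoint_def.1 (Submodule.orthogonal_disjoint _) _ hmem hperp
  rwa [sub_eq_zero.1 hzero]

theorem starCommutes_extension_iff (hK : K ∈ unitary (E →L[ℂ] E)) (hS : IsStrictlyPositive S)
    (hker : B.domain ≤ ker S.adjoint) (hmaps : ∀ f, B f ∈ B.domain.topologicalClosure)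
    (hKS : StarCommutes K S) :
    StarCommutes K (extension S hS.isNonnegSymmetric B) ↔ StarCommutes K B := by
  have hiso {U : E →L[ℂ] E} (hU : U ∈ unitary (E →L[ℂ] E)) : Isometry U :=
    U.isometry_iff_adjoint_comp_self.2 (Unitary.star_mul_self_of_mem hU)
  have hK₁ := hiso hK
  have hK₂ := hiso (Unitary.star_mem hK)
  exact ⟨fun h =>
      ⟨intertwines_of_intertwines_extension hK₁ hS hker hmaps hKS h.intertwines,
        intertwines_of_intertwines_extension hK₂ hS hker hmaps hKS.star h.star_intertwines⟩,
    fun h => ⟨hKS.intertwines_extension hK₁ hS hker h,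
      hKS.star.intertwines_extension hK₂ hS hker h.star⟩⟩

theorem isClosable_extension (hS : IsNonnegSymmetric S) (B : E →ₗ.[ℂ] E) :
    (extension S hS B).IsClosable :=
  (LinearPMap.adjoint_isClosed hS.dense).isClosable.leIsClosable LinearPMap.domRestrict_le

theorem dense_domain_extension (hS : IsNonnegSymmetric S) (B : E →ₗ.[ℂ] E) :
    Dense ((extension S hS B).domain : Set E) :=
  hS.dense.mono fun x hx => ⟨Submodule.mem_sup_left (Submodule.mem_sup_left hx),
    LinearPMap.mem_domain_of_mem_graph (hS.mem_graph_adjoint ⟨x, hx⟩)⟩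

end Extension

end UnboundedOp

open UnboundedOp in
theorem mainTheorem9_general {H : Type*} [NormedAddCommGroup H] [InnerProductSpace ℂ H]
    [CompleteSpace H] (K : H →L[ℂ] H) (hK : K ∈ unitary (H →L[ℂ] H))
    (S : H →ₗ.[ℂ] H) (hS : IsStrictlyPositive S) (hSK : IsInvariant K S)
    (B : H →ₗ.[ℂ] H) (hker : B.domain ≤ ker S.adjoint)
    (hmaps : ∀ f, B f ∈ B.domain.topologicalClosure) :
    IsInvariant K (extension S hS.isNonnegSymmetric B) ↔ conj K B = B := by
  have hKS : StarCommutes K S := (conj_eq_iff_starCommutes hK).1 hSK.conj_eq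
  calc IsInvariant K (extension S hS.isNonnegSymmetric B)
      ↔ conj K (extension S hS.isNonnegSymmetric B) = extension S hS.isNonnegSymmetric B :=
        ⟨IsInvariant.conj_eq, fun h =>
          ⟨hSK.invertible, dense_domain_extension _ B, isClosable_extension _ B, h⟩⟩
    _ ↔ StarCommutes K (extension S hS.isNonnegSymmetric B) := conj_eq_iff_starCommutes hK
    _ ↔ StarCommutes K B := starCommutes_extension_iff hK hS hker hmaps hKS
    _ ↔ conj K B = B := (conj_eq_iff_starCommutes hK).symm

theorem mainTheorem9 {H : Type*} [NormedAddCommGroup H] [InnerProductSpace ℂ H] [CompleteSpace H]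
    (K : H →L[ℂ] H) (hK : K ∈ unitary (H →L[ℂ] H))
    (S : H →ₗ.[ℂ] H) (hS : UnboundedOp.IsStrictlyPositive S) (hSclosed : S.IsClosed)
    (hSK : UnboundedOp.IsInvariant K S)
    (B : H →ₗ.[ℂ] H) (hB : UnboundedOp.IsAuxiliary S B) :
    UnboundedOp.IsInvariant K (UnboundedOp.extension S hS.isNonnegSymmetric B) ↔
      B.domain = (UnboundedOp.conj K B).domain ∧ UnboundedOp.conj K B = B :=
  (mainTheorem9_general K hK S hS hSK B
    (B.domain.le_topologicalClosure.trans hB.le_ker) hB.maps).trans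
    ⟨fun h => ⟨congrArg LinearPMap.domain h.symm, h⟩, And.right⟩
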